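/- Let $n\ge 1$, $c>0$, and let $\mu$ be the measure $d\mu=e^{c|x|^2}\,dx$ on $\mathbb R^n$. Write $\|f\|_r=\left(\int_{\mathbb R^n}|f|^r\,d\mu\right)^{1/r}$ for $1\le r<\infty$ and $\|f\|_\infty$ for the essential supremum of $|f|$. Let $C_0^\infty(\mathbb R^n)$ be the space of real-valued smooth functions with compact support. (i) Let $p\in[1,\infty)$, and suppose that $q\in[p,np/(n-p)]$ if $p<n$, that $q\in[n,\infty)$ if $p=n$, and that $q\in[p,\infty]$ if $p>n$. Then there is a constant $C=C(p,q)>0$ (depending also on the fixed $n$ and $c$) such that $$\|\nabla u\|_p\ \ge\ C(p,q)\,\|u\|_q\qquad\text{for every }u\in C_0^\infty(\mathbb R^n).$$ (ii) If $p\in(n,\infty)$, there is a constant $C=C(p)>0$ (depending also on $n$ and $c$) such that $$\|\nabla u\|_p\ \ge\ C(p)\,\|u\|_{C^{0,1-n/p}(\mathbb R^n)}\qquad\text{for every }u\in C_0^\infty(\mathbb R^n),$$ where $\|u\|_{C^{0,\alpha}(\mathbb R^n)}=\sup_{x}|u(x)|+\sup_{x\ne y}\frac{|u(x)-u(y)|}{|x-y|^\alpha}$.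 -/

import Mathlib

open MeasureTheory
open scoped ENNReal NNReal ContDiff

/-- The measure `dμ = exp (c |x|²) dx` on `ℝⁿ`. -/
noncomputable def expSqMeasure (n : ℕ) (c : ℝ) : Measure (EuclideanSpace ℝ (Fin n)) :=
  volume.withDensity fun x => ENNReal.ofReal (Real.exp (c * ‖x‖ ^ 2))

/-- `q ∈ [p, np/(n-p)]` if `1 ≤ p < n`, `q ∈ [n, ∞)` if `p = n`, and
`q ∈ [p, ∞]` if `n < p < ∞`. -/
def SobolevAdmissible (n : ℕ) (p : ℝ) (q : ℝ≥0∞) : Prop :=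
  (1 ≤ p ∧ p < n ∧ ENNReal.ofReal p ≤ q ∧ q ≤ ENNReal.ofReal (n * p / (n - p))) ∨
  (p = n ∧ (n : ℝ≥0∞) ≤ q ∧ q < ⊤) ∨
  ((n : ℝ) < p ∧ ENNReal.ofReal p ≤ q)

/-- The full Hölder norm of `C^{0,α}(ℝⁿ)`: supremum norm plus Hölder seminorm,
with values in `[0, ∞]`. -/
noncomputable def fullHolderNorm {n : ℕ} (α : ℝ≥0) (u : EuclideanSpace ℝ (Fin n) → ℝ) : ℝ≥0∞ :=
  (⨆ x, ‖u x‖ₑ) + eHolderNorm α u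

/-! The weight grows outwards, and this already gives a Poincaré inequality. If `inner ℝ x e ≤ 0`
and `s ≤ 0`, then ‖x + s e‖² ≥ ‖x‖² + s², so on a ray leaving the half-space the weight gains a
Gaussian factor in s. Bounding u(x) by the integral of its derivative along that ray, then using
Hölder, Tonelli and translation invariance, yields ‖u‖_p ≤ K‖∇u‖_p (`lintegral_rpow_mul_exp_le`).

For q > p, the Euclidean Sobolev inequality is applied to v = exp(c|x|²/q) u, whose Lebesgue L^q
norm is the weighted norm of u. The linear factor in ∇v is harmless: exp(c|x|²/q) is exp(c|x|²/p)
times a decaying Gaussian, which also pays for Hölder from L^p down to L^r. The term in |u| is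
removed by Poincaré (`eLpNorm_le_eLpNorm_fderiv_expSqMeasure_of_inv_eq`). Intermediate exponents
follow by interpolation.

For p > n, Morrey's estimates hold for Lebesgue measure; the weight is at least 1, so they pass to
μ, and Poincaré absorbs the norm of u. -/

/-! ### Poincaré inequality by integration along outward rays -/

section Poincare

variable {E : Type*} [NormedAddCommGroup E] [InnerProductSpace ℝ E]

/-- A compactly supported `C¹` function is bounded by the integral of its derivative along any
ray. -/
lemma enorm_le_lintegral_fderiv_ray {u : E → ℝ} (hu : ContDiff ℝ 1 u) (h2u : HasCompactSupport u)
    (x : E) {e : E} (he : ‖e‖ = 1) :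
    ‖u x‖ₑ ≤ ∫⁻ s in Set.Iic (0 : ℝ), ‖fderiv ℝ u (x + s • e)‖ₑ := by
  have hiso : Isometry fun s : ℝ => x + s • e := by
    refine Isometry.of_dist_eq fun s t => ?_
    rw [dist_add_left, dist_eq_norm, ← sub_smul, norm_smul, he, mul_one, dist_eq_norm]
  have hline : ∀ s : ℝ, HasDerivAt (fun s : ℝ => x + s • e) e s := fun s => by
    simpa using ((hasDerivAt_id s).smul_const e).const_add x
  have hf : ContDiff ℝ 1 fun s : ℝ => u (x + s • e) := hu.comp (by fun_prop)
  have h2f : HasCompactSupport fun s : ℝ => u (x + s • e) :=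
    h2u.comp_isClosedEmbedding hiso.isClosedEmbedding
  have h := HasCompactSupport.enorm_le_lintegral_Ici_deriv hf h2f 0
  simp only [zero_smul, add_zero] at h
  refine h.trans (lintegral_mono fun s => ?_)
  have hd : HasDerivAt (fun s : ℝ => u (x + s • e)) (fderiv ℝ u (x + s • e) e) s :=
    ((hu.differentiable one_ne_zero _).hasFDerivAt).comp_hasDerivAt s (hline s)
  rw [hd.deriv]
  refine (ContinuousLinearMap.le_opENorm _ _).trans ?_
  rw [← ofReal_norm e, he]; simp

lemma lintegral_exp_neg_mul_sq_lt_top {a : ℝ} (ha : 0 < a) :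
    ∫⁻ s in Set.Iic (0 : ℝ), ENNReal.ofReal (Real.exp (-a * s ^ 2)) < ⊤ :=
  (setLIntegral_le_lintegral _ _).trans_lt
    ((integrable_exp_neg_mul_sq ha).lintegral_lt_top)

/-- Hölder's inequality on a half line with a Gaussian weight. -/
lemma rpow_lintegral_le_gaussian {g : ℝ → ℝ} (hg : Continuous g) {p : ℝ} (hp : 1 ≤ p)
    (a : ℝ) :
    (∫⁻ s in Set.Iic (0 : ℝ), ‖g s‖ₑ) ^ p ≤
      (∫⁻ s in Set.Iic (0 : ℝ), ENNReal.ofReal (Real.exp (-a * s ^ 2))) ^ (p - 1) *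
        ∫⁻ s in Set.Iic (0 : ℝ), ‖g s‖ₑ ^ p * ENNReal.ofReal (Real.exp ((p * a - a) * s ^ 2)) := by
  set d : ℝ → ℝ≥0∞ := fun s => ENNReal.ofReal (Real.exp (-a * s ^ 2)) with hd
  have hdm : Measurable d := by fun_prop
  set ν : Measure ℝ := (volume.restrict (Set.Iic (0 : ℝ))).withDensity d with hν
  have hp0 : 0 < p := by linarith
  have hνu : ν Set.univ = ∫⁻ s in Set.Iic (0 : ℝ), d s := by
    rw [hν, withDensity_apply _ MeasurableSet.univ, Measure.restrict_univ]
  -- The L¹(ν) norm of h is the integral of |g|, so Hölder becomes the comparison of L¹ and L^p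
  -- norms against ν.
  set h : ℝ → ℝ := fun s => g s * Real.exp (a * s ^ 2) with hh
  have hhc : Continuous h := by fun_prop
  have henorm : ∀ s, ‖h s‖ₑ = ‖g s‖ₑ * ENNReal.ofReal (Real.exp (a * s ^ 2)) := fun s => by
    rw [hh, enorm_mul, Real.enorm_of_nonneg (Real.exp_pos _).le]
  have key := eLpNorm_le_eLpNorm_mul_rpow_measure_univ (μ := ν) (f := h) (p := 1)
    (q := ENNReal.ofReal p) (by simpa using hp) hhc.aestronglyMeasurable
  have hpr : (ENNReal.ofReal p).toReal = p := ENNReal.toReal_ofReal hp0.le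
  rw [eLpNorm_eq_lintegral_rpow_enorm_toReal (by simpa using hp0) ENNReal.ofReal_ne_top,
    eLpNorm_one_eq_lintegral_enorm, hpr, hνu,
    lintegral_withDensity_eq_lintegral_mul _ hdm (by fun_prop),
    lintegral_withDensity_eq_lintegral_mul _ hdm (by fun_prop)] at key
  have e1 : ∀ s, (d * fun s => ‖h s‖ₑ) s = ‖g s‖ₑ := fun s => by
    simp only [Pi.mul_apply, henorm, hd]
    rw [mul_left_comm, ← ENNReal.ofReal_mul (Real.exp_pos _).le, ← Real.exp_add]
    simp
  have e2 : ∀ s, (d * fun s => ‖h s‖ₑ ^ p) s =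
      ‖g s‖ₑ ^ p * ENNReal.ofReal (Real.exp ((p * a - a) * s ^ 2)) := fun s => by
    simp only [Pi.mul_apply, henorm, hd]
    rw [ENNReal.mul_rpow_of_nonneg _ _ hp0.le, mul_left_comm,
      ENNReal.ofReal_rpow_of_pos (Real.exp_pos _), ← ENNReal.ofReal_mul (Real.exp_pos _).le,
      ← Real.exp_mul, ← Real.exp_add]
    ring_nf
  simp_rw [e1, e2] at key
  refine (ENNReal.rpow_le_rpow key hp0.le).trans_eq ?_
  rw [ENNReal.mul_rpow_of_nonneg _ _ hp0.le, ← ENNReal.rpow_mul, ← ENNReal.rpow_mul,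
    one_div_mul_cancel hp0.ne', ENNReal.rpow_one, mul_comm]
  congr 2
  simp
  field_simp

variable [FiniteDimensional ℝ E] [MeasurableSpace E] [BorelSpace E]

/-- Both x and s e point away from e, so the cross term in ‖x + s e‖² is nonnegative. Hölder gives
N^(p-1), and the Gaussian left after integrating out x by translation gives the last factor N. -/
lemma setLIntegral_rpow_mul_exp_le_halfspace {c p : ℝ} (hc : 0 < c) (hp : 1 ≤ p) {u : E → ℝ}
    (hu : ContDiff ℝ 1 u) (h2u : HasCompactSupport u) {e : E} (he : ‖e‖ = 1) :
    ∫⁻ x in {x | inner ℝ x e ≤ 0}, ‖u x‖ₑ ^ p * ENNReal.ofReal (Real.exp (c * ‖x‖ ^ 2)) ≤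
      (∫⁻ s in Set.Iic (0 : ℝ), ENNReal.ofReal (Real.exp (-(c / p) * s ^ 2))) ^ p *
        ∫⁻ x, ‖fderiv ℝ u x‖ₑ ^ p * ENNReal.ofReal (Real.exp (c * ‖x‖ ^ 2)) := by
  have hp0 : 0 < p := by linarith
  have ha : 0 < c / p := by positivity
  set N := ∫⁻ s in Set.Iic (0 : ℝ), ENNReal.ofReal (Real.exp (-(c / p) * s ^ 2)) with hN
  have hNt : N < ⊤ := lintegral_exp_neg_mul_sq_lt_top ha
  have hDu : Continuous (fderiv ℝ u) := hu.continuous_fderiv one_ne_zero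
  set G : E → ℝ≥0∞ := fun x => ‖fderiv ℝ u x‖ₑ ^ p * ENNReal.ofReal (Real.exp (c * ‖x‖ ^ 2))
    with hG
  have hGm : Measurable G := by fun_prop
  have pt : ∀ x ∈ {x : E | inner ℝ x e ≤ 0},
      ‖u x‖ₑ ^ p * ENNReal.ofReal (Real.exp (c * ‖x‖ ^ 2)) ≤
      N ^ (p - 1) * ∫⁻ s in Set.Iic (0 : ℝ),
        G (x + s • e) * ENNReal.ofReal (Real.exp (-(c / p) * s ^ 2)) := by
    intro x hx
    have h1 := (ENNReal.rpow_le_rpow (enorm_le_lintegral_fderiv_ray hu h2u x he) hp0.le)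
    -- With a = c/p, Hölder costs exp((c - c/p)s²); the gain exp(-cs²) from the weight leaves
    -- exp(-(c/p)s²), the same Gaussian as in N.
    have h2 := rpow_lintegral_le_gaussian (g := fun s => ‖fderiv ℝ u (x + s • e)‖)
      (by fun_prop) hp (c / p)
    simp only [enorm_norm] at h2
    refine (mul_le_mul_left (h1.trans h2) _).trans ?_
    rw [mul_assoc]
    refine mul_le_mul_right ?_ _
    rw [← lintegral_mul_const' _ _ ENNReal.ofReal_ne_top]
    refine setLIntegral_mono' measurableSet_Iic fun s hs => ?_
    simp only [hG]
    rw [mul_assoc, mul_assoc, ← ENNReal.ofReal_mul (Real.exp_pos _).le,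
      ← ENNReal.ofReal_mul (Real.exp_pos _).le, ← Real.exp_add, ← Real.exp_add]
    refine mul_le_mul_right (ENNReal.ofReal_le_ofReal (Real.exp_le_exp.2 ?_)) _
    have hn : ‖x‖ ^ 2 + s ^ 2 ≤ ‖x + s • e‖ ^ 2 := by
      rw [norm_add_sq_real, inner_smul_right, norm_smul, he, mul_one, Real.norm_eq_abs, sq_abs]
      have := mul_nonneg_of_nonpos_of_nonpos (show s ≤ 0 from hs) (show inner ℝ x e ≤ 0 from hx)
      linarith
    have : p * (c / p) = c := by field_simp
    nlinarith [mul_le_mul_of_nonneg_left hn hc.le]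
  calc _ ≤ ∫⁻ x in {x : E | inner ℝ x e ≤ 0}, N ^ (p - 1) * ∫⁻ s in Set.Iic (0 : ℝ),
        G (x + s • e) * ENNReal.ofReal (Real.exp (-(c / p) * s ^ 2)) :=
        setLIntegral_mono' (measurableSet_le (by fun_prop) (by fun_prop)) pt
    _ ≤ ∫⁻ x, N ^ (p - 1) * ∫⁻ s in Set.Iic (0 : ℝ),
        G (x + s • e) * ENNReal.ofReal (Real.exp (-(c / p) * s ^ 2)) :=
        setLIntegral_le_lintegral _ _
    _ = N ^ (p - 1) * ∫⁻ s in Set.Iic (0 : ℝ), ∫⁻ x,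
        G (x + s • e) * ENNReal.ofReal (Real.exp (-(c / p) * s ^ 2)) := by
        rw [lintegral_const_mul' _ _ (ENNReal.rpow_ne_top_of_nonneg (by linarith) hNt.ne),
          lintegral_lintegral_swap]
        exact Measurable.aemeasurable (by fun_prop)
    _ = N ^ (p - 1) * (N * ∫⁻ x, G x) := by
        congr 1
        rw [hN, ← lintegral_mul_const _ (by fun_prop)]
        refine lintegral_congr fun s => ?_
        rw [lintegral_mul_const _ (by fun_prop), lintegral_add_right_eq_self G, mul_comm]
    _ = N ^ p * ∫⁻ x, G x := by
        have hN0 : N ≠ 0 := by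
          rw [hN, Ne, lintegral_eq_zero_iff (by fun_prop)]
          intro h
          have : (volume.restrict (Set.Iic (0 : ℝ))) Set.univ = 0 := by
            refine measure_mono_null (fun s _ => ?_) h
            simp [Real.exp_pos]
          simp at this
        rw [← mul_assoc]
        congr 1
        nth_rewrite 2 [← ENNReal.rpow_one N]
        rw [← ENNReal.rpow_add _ _ hN0 hNt.ne]
        simp

/-- The `Lᵖ` Poincaré inequality for the measure `exp (c |x|²) dx`. -/
lemma lintegral_rpow_mul_exp_le [Nontrivial E] {c p : ℝ} (hc : 0 < c) (hp : 1 ≤ p) :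
    ∃ K : ℝ≥0, ∀ u : E → ℝ, ContDiff ℝ 1 u → HasCompactSupport u →
      ∫⁻ x, ‖u x‖ₑ ^ p * ENNReal.ofReal (Real.exp (c * ‖x‖ ^ 2)) ≤
        K * ∫⁻ x, ‖fderiv ℝ u x‖ₑ ^ p * ENNReal.ofReal (Real.exp (c * ‖x‖ ^ 2)) := by
  have hp0 : 0 < p := by linarith
  set N := (∫⁻ s in Set.Iic (0 : ℝ), ENNReal.ofReal (Real.exp (-(c / p) * s ^ 2))) ^ p with hN
  have hNt : N ≠ ⊤ := ENNReal.rpow_ne_top_of_nonneg hp0.le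
    (lintegral_exp_neg_mul_sq_lt_top (by positivity)).ne
  obtain ⟨e, he⟩ := exists_norm_eq E zero_le_one
  refine ⟨(2 * N).toNNReal, fun u hu h2u => ?_⟩
  rw [ENNReal.coe_toNNReal (ENNReal.mul_ne_top (by simp) hNt), two_mul, add_mul]
  have h1 := setLIntegral_rpow_mul_exp_le_halfspace hc hp hu h2u he
  have h2 := setLIntegral_rpow_mul_exp_le_halfspace hc hp hu h2u (e := -e) (by rwa [norm_neg])
  refine le_trans ?_ (add_le_add h1 h2)
  refine le_trans ?_ (lintegral_union_le _ _ _)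
  -- The half-spaces for e and -e cover the space, hence the constant 2N.
  rw [← setLIntegral_univ]
  refine lintegral_mono_set fun x _ => ?_
  simpa using le_total _ _

end Poincare

/-! ### Morrey estimates for Lebesgue measure -/

section Morrey

open Module

variable {E : Type*} [NormedAddCommGroup E] [InnerProductSpace ℝ E]

lemma enorm_sub_le_lintegral_fderiv_segment {u : E → ℝ} (hu : ContDiff ℝ 1 u) (x z : E) {R : ℝ}
    (hz : ‖z - x‖ ≤ R) :
    ‖u z - u x‖ₑ ≤
      ∫⁻ t in Set.Ioc (0 : ℝ) 1, ENNReal.ofReal R * ‖fderiv ℝ u (x + t • (z - x))‖ₑ := by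
  have hline : ∀ t : ℝ, HasDerivAt (fun t : ℝ => x + t • (z - x)) (z - x) t := fun t => by
    simpa using ((hasDerivAt_id t).smul_const (z - x)).const_add x
  have hf : ContDiff ℝ 1 fun t : ℝ => u (x + t • (z - x)) := hu.comp (by fun_prop)
  have h := enorm_sub_le_lintegral_deriv_of_contDiffOn_Icc (hf.contDiffOn (s := Set.Icc 0 1))
    zero_le_one
  simp only [zero_smul, add_zero, one_smul, add_sub_cancel] at h
  rw [Measure.restrict_congr_set Ioc_ae_eq_Icc]
  refine h.trans (lintegral_mono fun t => ?_)
  have hd : HasDerivAt (fun t : ℝ => u (x + t • (z - x))) (fderiv ℝ u (x + t • (z - x)) (z - x)) t :=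
    ((hu.differentiable one_ne_zero _).hasFDerivAt).comp_hasDerivAt t (hline t)
  rw [hd.deriv]
  refine (ContinuousLinearMap.le_opENorm _ _).trans ?_
  rw [← ofReal_norm (z - x), mul_comm]
  gcongr

variable [FiniteDimensional ℝ E] [MeasurableSpace E] [BorelSpace E]

lemma lintegral_comp_homothety {F : E → ℝ≥0∞} (hF : Measurable F) (x : E) {t : ℝ} (ht : 0 < t) :
    ∫⁻ z, F (x + t • (z - x)) = ENNReal.ofReal (t ^ finrank ℝ E)⁻¹ * ∫⁻ z, F z := by
  have h1 : ∫⁻ z, F (x + t • (z - x)) = ∫⁻ z, F (x + t • z) :=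
    lintegral_sub_right_eq_self (fun z => F (x + t • z)) x
  have h2 : ∫⁻ z, F (x + t • z) = ∫⁻ z, F (x + z) ∂(Measure.map (t • ·) volume) :=
    (lintegral_map (hF.comp (by fun_prop)) (by fun_prop)).symm
  rw [h1, h2, Measure.map_addHaar_smul _ ht.ne', lintegral_smul_measure,
    lintegral_add_left_eq_self, abs_of_pos (by positivity), smul_eq_mul]

lemma lintegral_Ioc_rpow_lt_top {a : ℝ} (ha : -1 < a) :
    ∫⁻ t in Set.Ioc (0 : ℝ) 1, ENNReal.ofReal (t ^ a) < ⊤ :=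
  ((intervalIntegrable_iff_integrableOn_Ioc_of_le zero_le_one).1
    (intervalIntegral.intervalIntegrable_rpow' ha)).lintegral_lt_top

lemma setLIntegral_enorm_le_eLpNorm {F : Type*} [NormedAddCommGroup F] {f : E → F}
    (hf : Continuous f) {p : ℝ} (hp : 1 ≤ p) (B : Set E) :
    ∫⁻ z in B, ‖f z‖ₑ ≤ eLpNorm f (ENNReal.ofReal p) volume * volume B ^ (1 - 1 / p) := by
  have key := eLpNorm_le_eLpNorm_mul_rpow_measure_univ (μ := volume.restrict B) (f := f) (p := 1)
    (q := ENNReal.ofReal p) (by simpa using hp) hf.aestronglyMeasurable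
  rw [eLpNorm_one_eq_lintegral_enorm, Measure.restrict_apply_univ,
    ENNReal.toReal_ofReal (by linarith), ENNReal.toReal_one, div_one] at key
  exact key.trans (mul_le_mul_left (eLpNorm_restrict_le _ _ _ _) _)

lemma eLpNorm_comp_homothety {F : Type*} [NormedAddCommGroup F] {f : E → F} (hf : Continuous f)
    {p : ℝ} (hp : 0 < p) (x : E) {t : ℝ} (ht : 0 < t) :
    eLpNorm (fun z => f (x + t • (z - x))) (ENNReal.ofReal p) volume =
      ENNReal.ofReal (t ^ (-(finrank ℝ E / p))) * eLpNorm f (ENNReal.ofReal p) volume := by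
  have hm : Measurable fun z => ‖f z‖ₑ ^ p := hf.enorm.measurable.pow_const p
  rw [eLpNorm_eq_lintegral_rpow_enorm_toReal (by simpa using hp) ENNReal.ofReal_ne_top,
    eLpNorm_eq_lintegral_rpow_enorm_toReal (by simpa using hp) ENNReal.ofReal_ne_top,
    ENNReal.toReal_ofReal hp.le, lintegral_comp_homothety hm x ht,
    ENNReal.mul_rpow_of_nonneg _ _ (by positivity), ENNReal.ofReal_rpow_of_pos (by positivity)]
  congr 2
  rw [← Real.rpow_natCast, ← Real.rpow_neg ht.le, ← Real.rpow_mul ht.le]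
  congr 1
  ring

/-- The integral form of Morrey's inequality. -/
lemma setLIntegral_enorm_sub_le {p : ℝ} (hp : 1 ≤ p) {u : E → ℝ} (hu : ContDiff ℝ 1 u) {x : E}
    {R : ℝ} {B : Set E} (hB : MeasurableSet B) (hR : ∀ z ∈ B, ‖z - x‖ ≤ R) :
    ∫⁻ z in B, ‖u z - u x‖ₑ ≤
      volume B ^ (1 - 1 / p) * (ENNReal.ofReal R *
        ((∫⁻ t in Set.Ioc (0 : ℝ) 1, ENNReal.ofReal (t ^ (-(finrank ℝ E / p)))) *
          eLpNorm (fderiv ℝ u) (ENNReal.ofReal p) volume)) := by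
  have hDu : Continuous (fderiv ℝ u) := hu.continuous_fderiv one_ne_zero
  calc _ ≤ ∫⁻ z in B, ∫⁻ t in Set.Ioc (0 : ℝ) 1,
          ENNReal.ofReal R * ‖fderiv ℝ u (x + t • (z - x))‖ₑ :=
        setLIntegral_mono' hB fun z hz => enorm_sub_le_lintegral_fderiv_segment hu x z (hR z hz)
    _ = ∫⁻ t in Set.Ioc (0 : ℝ) 1, ∫⁻ z in B,
          ENNReal.ofReal R * ‖fderiv ℝ u (x + t • (z - x))‖ₑ :=
        lintegral_lintegral_swap (Measurable.aemeasurable (Measurable.const_mul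
          (Continuous.measurable (by fun_prop)) _))
    _ ≤ ∫⁻ t in Set.Ioc (0 : ℝ) 1, volume B ^ (1 - 1 / p) * (ENNReal.ofReal R *
          (eLpNorm (fderiv ℝ u) (ENNReal.ofReal p) volume)) *
            ENNReal.ofReal (t ^ (-(finrank ℝ E / p))) := by
        -- For fixed t, Hölder on B gives the volume factor, and undoing the homothety of ratio t
        -- about x costs t^(-n/p), integrable near 0 when n < p.
        refine setLIntegral_mono' measurableSet_Ioc fun t ht => ?_
        rw [lintegral_const_mul' _ _ ENNReal.ofReal_ne_top]
        refine (mul_le_mul_right (setLIntegral_enorm_le_eLpNorm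
          (f := fun z => fderiv ℝ u (x + t • (z - x))) (by fun_prop) hp B) _).trans_eq ?_
        rw [eLpNorm_comp_homothety hDu (by linarith) x ht.1]
        ring
    _ = _ := by
        rw [lintegral_const_mul _ (by fun_prop)]
        ring

/-- Turns an estimate integrated over a ball into a pointwise one. With s = 1/p, the surviving
V^(-1/p) times the radius produces the Hölder power 1 - n/p. -/
lemma ENNReal.le_rpow_neg_mul_of_mul_le {a V X : ℝ≥0∞} {s : ℝ} (hV : V ≠ 0) (hV' : V ≠ ⊤)
    (h : a * V ≤ V ^ (1 - s) * X) : a ≤ V ^ (-s) * X := by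
  calc a = a * V * V⁻¹ := by rw [mul_assoc, ENNReal.mul_inv_cancel hV hV', mul_one]
    _ ≤ V ^ (1 - s) * X * V⁻¹ := by gcongr
    _ = V ^ (-s) * X := by
      rw [mul_right_comm, ← ENNReal.rpow_neg_one, ← ENNReal.rpow_add _ _ hV hV']
      congr 2
      ring

/-- **Morrey's inequality**. -/
lemma enorm_sub_le_eLpNorm_fderiv {p : ℝ} (hp : 1 ≤ p) (hn : (finrank ℝ E : ℝ) < p) :
    ∃ K : ℝ≥0, ∀ u : E → ℝ, ContDiff ℝ 1 u → ∀ x y,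
      ‖u x - u y‖ₑ ≤ K * eLpNorm (fderiv ℝ u) (ENNReal.ofReal p) volume *
        ENNReal.ofReal (‖x - y‖ ^ (1 - finrank ℝ E / p)) := by
  have hp0 : 0 < p := by linarith
  set M := ∫⁻ t in Set.Ioc (0 : ℝ) 1, ENNReal.ofReal (t ^ (-(finrank ℝ E / p))) with hM
  have hMt : M ≠ ⊤ := (lintegral_Ioc_rpow_lt_top (by
    rw [neg_lt_neg_iff, div_lt_one hp0]; exact hn)).ne
  set β := volume (Metric.ball (0 : E) 1) with hβ
  have hβ0 : β ≠ 0 := (Metric.measure_ball_pos _ _ one_pos).ne'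
  have hβt : β ≠ ⊤ := measure_ball_lt_top.ne
  have hK : β ^ (-(1 / p)) * (3 * M) ≠ ⊤ :=
    ENNReal.mul_ne_top (ENNReal.rpow_ne_top_of_ne_zero hβ0 hβt) (ENNReal.mul_ne_top (by simp) hMt)
  refine ⟨(β ^ (-(1 / p)) * (3 * M)).toNNReal, fun u hu x y => ?_⟩
  rw [ENNReal.coe_toNNReal hK]
  rcases eq_or_ne x y with rfl | hxy
  · simp
  set D := eLpNorm (fderiv ℝ u) (ENNReal.ofReal p) volume
  set ρ := ‖x - y‖ with hρ
  have hρ0 : 0 < ρ := norm_pos_iff.2 (sub_ne_zero.2 hxy)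
  have hV : volume (Metric.ball x ρ) = ENNReal.ofReal (ρ ^ finrank ℝ E) * β :=
    Measure.addHaar_ball_of_pos _ _ hρ0
  have hV0 : volume (Metric.ball x ρ) ≠ 0 := (Metric.measure_ball_pos _ _ hρ0).ne'
  have hVt : volume (Metric.ball x ρ) ≠ ⊤ := measure_ball_lt_top.ne
  have h1 := setLIntegral_enorm_sub_le hp hu (x := x) (R := ρ) (B := Metric.ball x ρ)
    measurableSet_ball fun z hz => by rw [← dist_eq_norm]; exact (Metric.mem_ball.1 hz).le
  -- The ball about x serves both points: its elements lie within 2ρ of y. The radii ρ and 2ρ add up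
  -- to the 3 in the constant.
  have h2 := setLIntegral_enorm_sub_le hp hu (x := y) (R := 2 * ρ) (B := Metric.ball x ρ)
    measurableSet_ball fun z hz => by
      have := norm_sub_le_norm_sub_add_norm_sub z x y
      have := (mem_ball_iff_norm.1 hz).le
      linarith
  have h3 : ‖u x - u y‖ₑ * volume (Metric.ball x ρ) ≤
      volume (Metric.ball x ρ) ^ (1 - 1 / p) * (ENNReal.ofReal ρ * (3 * (M * D))) := by
    rw [← setLIntegral_const]
    calc _ ≤ ∫⁻ z in Metric.ball x ρ, (‖u z - u x‖ₑ + ‖u z - u y‖ₑ) := by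
          refine lintegral_mono fun z => ?_
          have : u x - u y = (u z - u y) - (u z - u x) := by ring
          rw [this, add_comm]
          exact enorm_sub_le
      _ = _ := lintegral_add_left (by have := hu.continuous; fun_prop) _
      _ ≤ _ := add_le_add h1 h2
      _ = _ := by
          rw [ENNReal.ofReal_mul zero_le_two, ENNReal.ofReal_ofNat]
          ring
  refine (ENNReal.le_rpow_neg_mul_of_mul_le hV0 hVt h3).trans_eq ?_
  rw [hV, ENNReal.mul_rpow_of_ne_top ENNReal.ofReal_ne_top hβt,
    ENNReal.ofReal_rpow_of_pos (by positivity)]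
  have : ENNReal.ofReal (ρ ^ (1 - finrank ℝ E / p)) =
      ENNReal.ofReal ((ρ ^ finrank ℝ E) ^ (-(1 / p))) * ENNReal.ofReal ρ := by
    rw [← ENNReal.ofReal_mul (by positivity)]
    congr 1
    rw [← Real.rpow_natCast, ← Real.rpow_mul hρ0.le]
    nth_rewrite 3 [← Real.rpow_one ρ]
    rw [← Real.rpow_add hρ0]
    congr 1
    ring
  rw [this]
  ring

/-- Average |u(x)| ≤ |u(z) - u(x)| + |u(z)| over the unit ball about x: the integral Morrey bound
controls the first term, Hölder the second. -/
lemma enorm_le_eLpNorm_add_eLpNorm_fderiv {p : ℝ} (hp : 1 ≤ p) (hn : (finrank ℝ E : ℝ) < p) :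
    ∃ K : ℝ≥0, ∀ u : E → ℝ, ContDiff ℝ 1 u → ∀ x,
      ‖u x‖ₑ ≤ K * (eLpNorm (fderiv ℝ u) (ENNReal.ofReal p) volume +
        eLpNorm u (ENNReal.ofReal p) volume) := by
  have hp0 : 0 < p := by linarith
  set M := ∫⁻ t in Set.Ioc (0 : ℝ) 1, ENNReal.ofReal (t ^ (-(finrank ℝ E / p))) with hM
  have hMt : M ≠ ⊤ := (lintegral_Ioc_rpow_lt_top (by
    rw [neg_lt_neg_iff, div_lt_one hp0]; exact hn)).ne
  set β := volume (Metric.ball (0 : E) 1) with hβ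
  have hβ0 : β ≠ 0 := (Metric.measure_ball_pos _ _ one_pos).ne'
  have hβt : β ≠ ⊤ := measure_ball_lt_top.ne
  have hK : β ^ (-(1 / p)) * (M + 1) ≠ ⊤ :=
    ENNReal.mul_ne_top (ENNReal.rpow_ne_top_of_ne_zero hβ0 hβt) (ENNReal.add_ne_top.2 ⟨hMt, by simp⟩)
  refine ⟨(β ^ (-(1 / p)) * (M + 1)).toNNReal, fun u hu x => ?_⟩
  rw [ENNReal.coe_toNNReal hK]
  have hV : volume (Metric.ball x 1) = β := Measure.addHaar_ball_center _ _ _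
  have h1 := setLIntegral_enorm_sub_le hp hu (x := x) (R := 1) (B := Metric.ball x 1)
    measurableSet_ball fun z hz => by rw [← dist_eq_norm]; exact (Metric.mem_ball.1 hz).le
  have h2 := setLIntegral_enorm_le_eLpNorm hu.continuous hp (Metric.ball x 1)
  rw [hV] at h1 h2
  have h3 : ‖u x‖ₑ * β ≤ β ^ (1 - 1 / p) *
      (M * eLpNorm (fderiv ℝ u) (ENNReal.ofReal p) volume +
        eLpNorm u (ENNReal.ofReal p) volume) := by
    rw [← hV, ← setLIntegral_const, hV]
    calc _ ≤ ∫⁻ z in Metric.ball x 1, (‖u z - u x‖ₑ + ‖u z‖ₑ) := by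
          refine lintegral_mono fun z => ?_
          have : u x = u z - (u z - u x) := by ring
          rw [add_comm]
          nth_rewrite 1 [this]
          exact enorm_sub_le
      _ = _ := lintegral_add_left (by have := hu.continuous; fun_prop) _
      _ ≤ _ := add_le_add h1 h2
      _ = _ := by
          rw [ENNReal.ofReal_one]
          ring
  refine (ENNReal.le_rpow_neg_mul_of_mul_le hβ0 hβt h3).trans ?_
  rw [mul_assoc]
  gcongr
  rw [add_mul, one_mul]
  gcongr ?_ + ?_
  · gcongr
    exact le_self_add
  · exact le_add_self

end Morrey

/-! ### Interpolation between Lebesgue exponents -/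

section Interpolation

variable {α F : Type*} [MeasurableSpace α] {μ : Measure α} [NormedAddCommGroup F]

lemma ENNReal.rpow_le_rpow_sub_mul_of_le {a A : ℝ≥0∞} {s q : ℝ} (hs : 0 < s) (hsq : s ≤ q)
    (ha : a ≠ ⊤) (h : a ≤ A) : a ^ q ≤ A ^ (q - s) * a ^ s := by
  rcases eq_or_ne a 0 with rfl | ha0
  · simp [ENNReal.zero_rpow_of_pos (hs.trans_le hsq)]
  calc a ^ q = a ^ (q - s) * a ^ s := by rw [← ENNReal.rpow_add _ _ ha0 ha, sub_add_cancel]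
    _ ≤ _ := by
      gcongr

lemma ENNReal.rpow_le_rpow_sub_mul_of_ge {a A : ℝ≥0∞} {s q : ℝ} (hqs : q ≤ s)
    (hA : A ≠ 0) (ha : a ≠ ⊤) (h : A ≤ a) : a ^ q ≤ A ^ (q - s) * a ^ s := by
  have ha0 : a ≠ 0 := (hA.bot_lt.trans_le h).ne'
  calc a ^ q = a ^ (q - s) * a ^ s := by rw [← ENNReal.rpow_add _ _ ha0 ha, sub_add_cancel]
    _ ≤ _ := by
      refine mul_le_mul_left ?_ _
      rw [← neg_sub, ENNReal.rpow_neg, ENNReal.rpow_neg A]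
      exact ENNReal.inv_le_inv.2 (ENNReal.rpow_le_rpow h (by linarith))

/-- A function bounded in `Lᵖ` and in `L^Q` is bounded in `L^q` for all `q` between. -/
lemma eLpNorm_le_two_mul_of_le {p q : ℝ} {Q A : ℝ≥0∞} (hp : 1 ≤ p) (hpq : p ≤ q)
    (hqQ : ENNReal.ofReal q ≤ Q) {f : α → F} (hf : AEStronglyMeasurable f μ)
    (h1 : eLpNorm f (ENNReal.ofReal p) μ ≤ A) (h2 : eLpNorm f Q μ ≤ A) :
    eLpNorm f (ENNReal.ofReal q) μ ≤ 2 * A := by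
  have hp0 : 0 < p := by linarith
  have hq0 : 0 < q := by linarith
  have conv : ∀ s : ℝ, 0 < s → ∀ B : ℝ≥0∞,
      eLpNorm f (ENNReal.ofReal s) μ ≤ B ↔ ∫⁻ x, ‖f x‖ₑ ^ s ∂μ ≤ B ^ s := fun s hs B => by
    rw [eLpNorm_eq_lintegral_rpow_enorm_toReal (by simpa using hs) ENNReal.ofReal_ne_top,
      ENNReal.toReal_ofReal hs.le, one_div, ENNReal.rpow_inv_le_iff hs]
  rcases eq_or_ne A 0 with rfl | hA0
  · have hf0 : f =ᵐ[μ] 0 :=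
      (eLpNorm_eq_zero_iff hf (by simpa using hp0)).1 (nonpos_iff_eq_zero.1 h1)
    rw [eLpNorm_congr_ae hf0]
    simp
  rcases eq_or_ne A ⊤ with rfl | hAt
  · simp
  rw [conv q hq0]
  rw [conv p hp0] at h1
  have hm : ∀ s : ℝ, AEMeasurable (fun x => ‖f x‖ₑ ^ s) μ := fun s => hf.enorm.pow_const s
  have hAA : ∀ s : ℝ, A ^ (q - s) * A ^ s = A ^ q := fun s => by
    rw [← ENNReal.rpow_add _ _ hA0 hAt, sub_add_cancel]
  have hlow : ∫⁻ x, A ^ (q - p) * ‖f x‖ₑ ^ p ∂μ ≤ A ^ q := by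
    rw [lintegral_const_mul'' _ (hm p), ← hAA p]
    gcongr
  -- The constant 2 suffices because 2 ≤ 2^q for q ≥ 1.
  have hfin : A ^ q + A ^ q ≤ (2 * A) ^ q := by
    rw [ENNReal.mul_rpow_of_nonneg _ _ hq0.le, ← two_mul]
    gcongr
    exact ENNReal.le_rpow_self_of_one_le one_le_two (hp.trans hpq)
  refine le_trans ?_ hfin
  rcases eq_or_ne Q ⊤ with rfl | hQ
  · rw [eLpNorm_exponent_top] at h2
    refine le_trans ?_ (hlow.trans le_self_add)
    refine lintegral_mono_ae ?_
    filter_upwards [ae_le_eLpNormEssSup (f := f) (μ := μ)] with x hx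
    exact ENNReal.rpow_le_rpow_sub_mul_of_le hp0 hpq enorm_ne_top (hx.trans h2)
  obtain ⟨r, hr, rfl⟩ : ∃ r : ℝ, 0 ≤ r ∧ Q = ENNReal.ofReal r :=
    ⟨Q.toReal, ENNReal.toReal_nonneg, (ENNReal.ofReal_toReal hQ).symm⟩
  have hqr : q ≤ r := (ENNReal.ofReal_le_ofReal_iff hr).1 hqQ
  rw [conv r (by linarith)] at h2
  -- Split at height A: smaller values are compared with exponent p, larger ones with exponent r.
  calc ∫⁻ x, ‖f x‖ₑ ^ q ∂μ ≤ ∫⁻ x, (A ^ (q - p) * ‖f x‖ₑ ^ p + A ^ (q - r) * ‖f x‖ₑ ^ r) ∂μ := by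
        refine lintegral_mono fun x => ?_
        rcases le_total ‖f x‖ₑ A with h | h
        · exact (ENNReal.rpow_le_rpow_sub_mul_of_le hp0 hpq enorm_ne_top h).trans le_self_add
        · exact (ENNReal.rpow_le_rpow_sub_mul_of_ge hqr hA0 enorm_ne_top h).trans le_add_self
    _ = _ := lintegral_add_left' ((hm p).const_mul _) _
    _ ≤ A ^ q + A ^ q := by
        refine add_le_add hlow ?_
        rw [lintegral_const_mul'' _ (hm r), ← hAA r]
        gcongr

end Interpolation

/-! ### Weighted Sobolev and Hölder inequalities -/

section Weighted

open Module

variable {n : ℕ} {c : ℝ}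

local notation "𝔼" => EuclideanSpace ℝ (Fin n)

lemma volume_le_expSqMeasure (hc : 0 < c) : (volume : Measure 𝔼) ≤ expSqMeasure n c := by
  nth_rewrite 1 [← withDensity_one (μ := (volume : Measure 𝔼))]
  refine withDensity_mono (Filter.Eventually.of_forall fun x => ?_)
  rw [Pi.one_apply, ENNReal.one_le_ofReal, Real.one_le_exp_iff]
  positivity

lemma eLpNorm_expSqMeasure {F : Type*} [NormedAddCommGroup F] {f : 𝔼 → F}
    (hf : Continuous f) {p : ℝ} (hp : 0 < p) :
    eLpNorm f (ENNReal.ofReal p) (expSqMeasure n c) =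
      (∫⁻ x, ‖f x‖ₑ ^ p * ENNReal.ofReal (Real.exp (c * ‖x‖ ^ 2))) ^ p⁻¹ := by
  rw [eLpNorm_eq_lintegral_rpow_enorm_toReal (by simpa using hp) ENNReal.ofReal_ne_top,
    ENNReal.toReal_ofReal hp.le, expSqMeasure, lintegral_withDensity_eq_lintegral_mul _
      (by fun_prop) (hf.enorm.measurable.pow_const p), one_div]
  simp only [Pi.mul_apply, mul_comm]

lemma eLpNorm_expSqMeasure_eq_volume {F : Type*} [NormedAddCommGroup F] [NormedSpace ℝ F]
    {f : 𝔼 → F} (hf : Continuous f) {p : ℝ} (hp : 0 < p) :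
    eLpNorm f (ENNReal.ofReal p) (expSqMeasure n c) =
      eLpNorm (fun x => Real.exp (c / p * ‖x‖ ^ 2) • f x) (ENNReal.ofReal p) volume := by
  rw [eLpNorm_expSqMeasure hf hp,
    eLpNorm_eq_lintegral_rpow_enorm_toReal (by simpa using hp) ENNReal.ofReal_ne_top,
    ENNReal.toReal_ofReal hp.le, one_div]
  congr 2
  ext x
  rw [enorm_smul, ENNReal.mul_rpow_of_nonneg _ _ hp.le, Real.enorm_of_nonneg (Real.exp_pos _).le,
    ENNReal.ofReal_rpow_of_pos (Real.exp_pos _), ← Real.exp_mul, mul_comm]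
  congr 3
  field_simp

/-- The Poincaré inequality in terms of `Lᵖ` norms. -/
lemma eLpNorm_le_eLpNorm_fderiv_expSqMeasure (hn : 1 ≤ n) (hc : 0 < c) {p : ℝ} (hp : 1 ≤ p) :
    ∃ K : ℝ≥0, ∀ u : 𝔼 → ℝ, ContDiff ℝ 1 u → HasCompactSupport u →
      eLpNorm u (ENNReal.ofReal p) (expSqMeasure n c) ≤
        K * eLpNorm (fderiv ℝ u) (ENNReal.ofReal p) (expSqMeasure n c) := by
  have hp0 : 0 < p := by linarith
  have : Nonempty (Fin n) := ⟨⟨0, hn⟩⟩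
  obtain ⟨K, hK⟩ := lintegral_rpow_mul_exp_le (E := 𝔼) hc hp
  refine ⟨K ^ p⁻¹, fun u hu h2u => ?_⟩
  rw [eLpNorm_expSqMeasure hu.continuous hp0,
    eLpNorm_expSqMeasure (hu.continuous_fderiv one_ne_zero) hp0,
    ENNReal.coe_rpow_of_nonneg _ (by positivity : 0 ≤ p⁻¹),
    ← ENNReal.mul_rpow_of_nonneg _ _ (by positivity)]
  exact ENNReal.rpow_le_rpow (hK u hu h2u) (by positivity)

lemma integrable_exp_neg_mul_norm_sq {a : ℝ} (ha : 0 < a) :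
    Integrable fun x : 𝔼 => Real.exp (-a * ‖x‖ ^ 2) := by
  have h := (GaussianFourier.integrable_cexp_neg_mul_sq_norm_add (V := 𝔼) (b := a) (by simpa)
    0 0).norm
  refine h.congr (Filter.Eventually.of_forall fun x => ?_)
  simp only [Complex.norm_exp]
  congr 1
  simp [← Complex.ofReal_pow]

/-- Half of the Gaussian absorbs the linear factor, through at ≤ a²/δ + δt²/2 and 1 + y ≤ exp y. -/
lemma one_add_mul_exp_neg_le {a δ : ℝ} (hδ : 0 < δ) (t : ℝ) :
    (1 + a * t) * Real.exp (-δ * t ^ 2) ≤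
      (1 + a ^ 2 / δ) * Real.exp (-(δ / 2) * t ^ 2) := by
  have h1 : Real.exp (-δ * t ^ 2) = Real.exp (-(δ / 2) * t ^ 2) * (Real.exp (δ / 2 * t ^ 2))⁻¹ := by
    rw [← Real.exp_neg, ← Real.exp_add]
    ring_nf
  have h2 : 1 + a * t ≤ (1 + a ^ 2 / δ) * Real.exp (δ / 2 * t ^ 2) := by
    have h3 : δ / 2 * t ^ 2 + 1 ≤ Real.exp (δ / 2 * t ^ 2) := Real.add_one_le_exp _
    have h4 : 0 ≤ a ^ 2 / δ := by positivity
    have h5 : a * t ≤ a ^ 2 / δ + δ / 2 * t ^ 2 := by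
      have : a ^ 2 / δ + δ / 2 * t ^ 2 - a * t =
          ((a - δ * t / 2) ^ 2 + (δ * t / 2) ^ 2) / δ := by field_simp; ring
      have : 0 ≤ ((a - δ * t / 2) ^ 2 + (δ * t / 2) ^ 2) / δ := by positivity
      linarith
    have h6 : 0 ≤ δ / 2 * t ^ 2 := by positivity
    nlinarith [mul_le_mul_of_nonneg_left h3 (add_nonneg zero_le_one h4), mul_nonneg h4 h6]
  rw [h1, ← mul_assoc, mul_right_comm]
  refine mul_le_mul_of_nonneg_right ?_ (Real.exp_pos _).le
  rwa [← div_eq_mul_inv, div_le_iff₀ (Real.exp_pos _)]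

/-- The function is integrable and bounded, so interpolation between L¹ and L^∞ covers every s. -/
lemma eLpNorm_one_add_mul_exp_neg_lt_top {a δ : ℝ} (ha : 0 ≤ a) (hδ : 0 < δ) {s : ℝ≥0∞}
    (hs : 1 ≤ s) :
    eLpNorm (fun x : 𝔼 => (1 + a * ‖x‖) * Real.exp (-δ * ‖x‖ ^ 2)) s volume < ⊤ := by
  set φ := fun x : 𝔼 => (1 + a * ‖x‖) * Real.exp (-δ * ‖x‖ ^ 2) with hφ
  have hc : Continuous φ := by fun_prop
  have hφ0 : ∀ x, 0 ≤ φ x := fun x => by simp only [hφ]; positivity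
  have hint : eLpNorm φ (ENNReal.ofReal 1) volume < ⊤ := by
    rw [ENNReal.ofReal_one]
    refine (memLp_one_iff_integrable.2 ?_).2
    refine ((integrable_exp_neg_mul_norm_sq (half_pos hδ)).const_mul (1 + a ^ 2 / δ)).mono'
      hc.aestronglyMeasurable (Filter.Eventually.of_forall fun x => ?_)
    rw [Real.norm_of_nonneg (hφ0 x)]
    exact one_add_mul_exp_neg_le hδ _
  have htop : eLpNorm φ ⊤ volume < ⊤ := by
    refine (memLp_top_of_bound hc.aestronglyMeasurable (1 + a ^ 2 / δ)
      (Filter.Eventually.of_forall fun x => ?_)).2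
    rw [Real.norm_of_nonneg (hφ0 x)]
    refine (one_add_mul_exp_neg_le hδ _).trans (mul_le_of_le_one_right (by positivity) ?_)
    rw [Real.exp_le_one_iff]
    have : 0 ≤ δ / 2 * ‖x‖ ^ 2 := by positivity
    linarith
  rcases eq_or_ne s ⊤ with rfl | hst
  · exact htop
  rw [← ENNReal.ofReal_toReal hst]
  refine (eLpNorm_le_two_mul_of_le le_rfl ?_ le_top hc.aestronglyMeasurable
    (le_max_left _ (eLpNorm φ ⊤ volume)) (le_max_right _ _)).trans_lt
    (ENNReal.mul_lt_top (by simp) (max_lt hint htop))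
  rwa [← ENNReal.toReal_one, ENNReal.toReal_le_toReal ENNReal.one_ne_top hst]

lemma norm_fderiv_exp_mul_le {b : ℝ} (hb : 0 ≤ b) {u : 𝔼 → ℝ} (hu : ContDiff ℝ 1 u) (x : 𝔼) :
    ‖fderiv ℝ (fun x => Real.exp (b * ‖x‖ ^ 2) * u x) x‖ ≤
      Real.exp (b * ‖x‖ ^ 2) * ((1 + 2 * b * ‖x‖) * (‖fderiv ℝ u x‖ + ‖u x‖)) := by
  have h1 := (((hasStrictFDerivAt_norm_sq x).hasFDerivAt.const_mul b).exp).mul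
    (hu.differentiable one_ne_zero x).hasFDerivAt
  have h2 : ‖fderiv ℝ (fun x => Real.exp (b * ‖x‖ ^ 2) * u x) x‖ ≤
      Real.exp (b * ‖x‖ ^ 2) * ‖fderiv ℝ u x‖ +
        ‖u x‖ * (Real.exp (b * ‖x‖ ^ 2) * (b * (2 * ‖x‖))) := by
    have h3 : fderiv ℝ (fun x => Real.exp (b * ‖x‖ ^ 2) * u x) x = _ := h1.fderiv
    rw [h3]
    refine (norm_add_le _ _).trans ?_
    rw [norm_smul, norm_smul, norm_smul, norm_smul, Real.norm_of_nonneg (Real.exp_pos _).le,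
      Real.norm_of_nonneg hb]
    gcongr
    refine (norm_nsmul_le).trans ?_
    simp [innerSL_apply_norm]
  refine h2.trans ?_
  have he := (Real.exp_pos (b * ‖x‖ ^ 2)).le
  have : 0 ≤ 2 * b * ‖x‖ * ‖fderiv ℝ u x‖ := by positivity
  have : 0 ≤ ‖u x‖ := norm_nonneg _
  nlinarith [mul_nonneg he ‹0 ≤ 2 * b * ‖x‖ * ‖fderiv ℝ u x‖›, mul_nonneg he this]

/-- The Sobolev inequality for the measure `exp (c |x|²) dx`, at an exponent `q > p` which is
critical for some `r ≤ p`. -/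
lemma eLpNorm_le_eLpNorm_fderiv_expSqMeasure_of_inv_eq (hn : 1 ≤ n) (hc : 0 < c) {r p q : ℝ}
    (hr : 1 ≤ r) (hrp : r ≤ p) (hpq : p < q) (hq : q⁻¹ = r⁻¹ - (n : ℝ)⁻¹) :
    ∃ K : ℝ≥0, ∀ u : 𝔼 → ℝ, ContDiff ℝ 1 u → HasCompactSupport u →
      eLpNorm u (ENNReal.ofReal q) (expSqMeasure n c) ≤
        K * eLpNorm (fderiv ℝ u) (ENNReal.ofReal p) (expSqMeasure n c) := by
  have hr0 : 0 < r := by linarith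
  have hp0 : 0 < p := by linarith
  have hq0 : 0 < q := by linarith
  obtain ⟨K₀, hK₀⟩ := eLpNorm_le_eLpNorm_fderiv_expSqMeasure hn hc (hr.trans hrp)
  set b := c / q with hb
  have hb0 : 0 < b := by positivity
  -- Positive exactly because q > p; this is the rate of the Gaussian left over after the weight for
  -- L^p is split off.
  set δ := c / p - c / q with hδ
  have hδ0 : 0 < δ := sub_pos.2 (div_lt_div_of_pos_left hc hp0 hpq)
  set φ : 𝔼 → ℝ := fun x => (1 + 2 * b * ‖x‖) * Real.exp (-δ * ‖x‖ ^ 2) with hφ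
  -- Hölder exponent with 1/s + 1/p = 1/r; when r = p it is ⊤.
  set s : ℝ≥0∞ := ((ENNReal.ofReal r)⁻¹ - (ENNReal.ofReal p)⁻¹)⁻¹ with hs
  have hs1 : 1 ≤ s := by
    rw [hs, ENNReal.one_le_inv]
    exact tsub_le_self.trans (ENNReal.inv_le_one.2 (by simpa using hr))
  have : ENNReal.HolderTriple s (ENNReal.ofReal p) (ENNReal.ofReal r) := ⟨by
    rw [hs, inv_inv]
    exact tsub_add_cancel_of_le (ENNReal.inv_le_inv.2 (ENNReal.ofReal_le_ofReal hrp))⟩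
  have hφt : eLpNorm φ s volume ≠ ⊤ :=
    (eLpNorm_one_add_mul_exp_neg_lt_top (by positivity) hδ0 hs1).ne
  set S : ℝ≥0 := SNormLESNormFDerivOfEqConst ℝ (volume : Measure 𝔼) r.toNNReal
  refine ⟨S * ((eLpNorm φ s volume).toNNReal * (1 + K₀)), fun u hu h2u => ?_⟩
  have hDu : Continuous (fderiv ℝ u) := hu.continuous_fderiv one_ne_zero
  have huc := hu.continuous
  set D := eLpNorm (fderiv ℝ u) (ENNReal.ofReal p) (expSqMeasure n c)
  have hv : ContDiff ℝ 1 fun x => Real.exp (b * ‖x‖ ^ 2) * u x :=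
    ((contDiff_const.mul (contDiff_norm_sq ℝ)).exp).mul hu
  have hsob := eLpNorm_le_eLpNorm_fderiv_of_eq (μ := (volume : Measure 𝔼)) hv h2u.mul_left
    (p := r.toNNReal) (p' := q.toNNReal) (by simpa using hr)
    (by simpa using Nat.lt_of_succ_le hn) (by simpa [hr0.le, hq0.le] using hq)
  set G : 𝔼 → ℝ := fun x => ‖fderiv ℝ u x‖ + ‖u x‖ with hG
  have hGc : Continuous G := by fun_prop
  have hfd : eLpNorm (fderiv ℝ fun x => Real.exp (b * ‖x‖ ^ 2) * u x) (ENNReal.ofReal r) volume ≤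
      eLpNorm φ s volume * ((1 + K₀) * D) := by
    calc _ ≤ eLpNorm (φ • fun x => Real.exp (c / p * ‖x‖ ^ 2) • G x) (ENNReal.ofReal r) volume := by
          refine eLpNorm_mono fun x => (norm_fderiv_exp_mul_le hb0.le hu x).trans
            (le_trans (le_of_eq ?_) (Real.le_norm_self _))
          have : Real.exp (b * ‖x‖ ^ 2) =
              Real.exp (-δ * ‖x‖ ^ 2) * Real.exp (c / p * ‖x‖ ^ 2) := by
            rw [← Real.exp_add, hδ, hb]
            ring_nf
          simp only [hφ, hG, this, Pi.smul_apply', smul_eq_mul]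
          ring
      _ ≤ eLpNorm φ s volume *
            eLpNorm (fun x => Real.exp (c / p * ‖x‖ ^ 2) • G x) (ENNReal.ofReal p) volume :=
          eLpNorm_smul_le_mul_eLpNorm (Continuous.aestronglyMeasurable (by fun_prop))
            (Continuous.aestronglyMeasurable (by fun_prop))
      _ = eLpNorm φ s volume * eLpNorm G (ENNReal.ofReal p) (expSqMeasure n c) := by
          rw [eLpNorm_expSqMeasure_eq_volume hGc hp0]
      _ ≤ _ := by
          gcongr
          refine (eLpNorm_add_le (hDu.norm.aestronglyMeasurable) (huc.norm.aestronglyMeasurable)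
            (by simpa using hr.trans hrp)).trans ?_
          rw [eLpNorm_norm, eLpNorm_norm, add_mul, one_mul]
          gcongr
          exact hK₀ u hu h2u
  rw [eLpNorm_expSqMeasure_eq_volume huc hq0]
  refine hsob.trans ?_
  push_cast
  rw [ENNReal.coe_toNNReal hφt, mul_assoc, mul_assoc]
  gcongr
  exact hfd

/-- Serves the case p = n = 1, where the exponent r = Q/(1 + Q) needed for Sobolev would fall below
1. -/
lemma enorm_le_eLpNorm_fderiv_one_dim {u : EuclideanSpace ℝ (Fin 1) → ℝ} (hu : ContDiff ℝ 1 u)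
    (h2u : HasCompactSupport u) (x : EuclideanSpace ℝ (Fin 1)) :
    ‖u x‖ₑ ≤ eLpNorm (fderiv ℝ u) 1 volume := by
  set b := OrthonormalBasis.singleton (Fin 1) ℝ
  have he : ‖b.repr 1‖ = 1 := (b.repr.norm_map 1).trans norm_one
  have hsmul : ∀ s : ℝ, s • b.repr 1 = b.repr s := fun s => by
    rw [← LinearIsometryEquiv.map_smul, smul_eq_mul, mul_one]
  have hDu : Continuous (fderiv ℝ u) := hu.continuous_fderiv one_ne_zero
  refine (enorm_le_lintegral_fderiv_ray hu h2u x he).trans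
    ((setLIntegral_le_lintegral _ _).trans_eq ?_)
  simp_rw [hsmul]
  rw [b.measurePreserving_repr.lintegral_comp (f := fun y => ‖fderiv ℝ u (x + y)‖ₑ)
    (Continuous.measurable (by fun_prop)), lintegral_add_left_eq_self (fun y => ‖fderiv ℝ u y‖ₑ),
    eLpNorm_one_eq_lintegral_enorm]
  rfl

/-- For `p > n` the supremum is controlled by the weighted `Lᵖ` norm of the derivative. -/
lemma enorm_le_eLpNorm_fderiv_expSqMeasure (hn : 1 ≤ n) (hc : 0 < c) {p : ℝ} (hp : (n : ℝ) < p) :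
    ∃ K : ℝ≥0, ∀ u : 𝔼 → ℝ, ContDiff ℝ 1 u → HasCompactSupport u → ∀ x,
      ‖u x‖ₑ ≤ K * eLpNorm (fderiv ℝ u) (ENNReal.ofReal p) (expSqMeasure n c) := by
  have hp1 : 1 ≤ p := le_trans (by exact_mod_cast hn) hp.le
  obtain ⟨K₀, hK₀⟩ := eLpNorm_le_eLpNorm_fderiv_expSqMeasure hn hc hp1
  obtain ⟨K₁, hK₁⟩ := enorm_le_eLpNorm_add_eLpNorm_fderiv (E := 𝔼) hp1 (by simpa using hp)
  refine ⟨K₁ * (1 + K₀), fun u hu h2u x => (hK₁ u hu x).trans ?_⟩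
  push_cast
  rw [mul_assoc, add_mul, one_mul]
  gcongr
  · exact volume_le_expSqMeasure hc
  · exact (eLpNorm_mono_measure _ (volume_le_expSqMeasure hc)).trans (hK₀ u hu h2u)

lemma eLpNorm_top_expSqMeasure_le {u : 𝔼 → ℝ} {A : ℝ≥0∞} (h : ∀ x, ‖u x‖ₑ ≤ A) :
    eLpNorm u ⊤ (expSqMeasure n c) ≤ A := by
  rw [eLpNorm_exponent_top]
  exact eLpNormEssSup_le_of_ae_enorm_bound (Filter.Eventually.of_forall h)

/-- Interpolation between the Poincaré inequality and a bound at a larger exponent `Q`. -/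
lemma eLpNorm_le_eLpNorm_fderiv_expSqMeasure_of_le (hn : 1 ≤ n) (hc : 0 < c) {p : ℝ} (hp : 1 ≤ p)
    {q Q : ℝ≥0∞} (hpq : ENNReal.ofReal p ≤ q) (hqQ : q ≤ Q)
    (hQ : ∃ K : ℝ≥0, ∀ u : 𝔼 → ℝ, ContDiff ℝ 1 u → HasCompactSupport u →
      eLpNorm u Q (expSqMeasure n c) ≤
        K * eLpNorm (fderiv ℝ u) (ENNReal.ofReal p) (expSqMeasure n c)) :
    ∃ K : ℝ≥0, ∀ u : 𝔼 → ℝ, ContDiff ℝ 1 u → HasCompactSupport u →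
      eLpNorm u q (expSqMeasure n c) ≤
        K * eLpNorm (fderiv ℝ u) (ENNReal.ofReal p) (expSqMeasure n c) := by
  rcases eq_or_ne q ⊤ with rfl | hqt
  · rwa [top_le_iff.1 hqQ] at hQ
  obtain ⟨K₀, hK₀⟩ := eLpNorm_le_eLpNorm_fderiv_expSqMeasure hn hc hp
  obtain ⟨K₁, hK₁⟩ := hQ
  refine ⟨2 * max K₀ K₁, fun u hu h2u => ?_⟩
  rw [← ENNReal.ofReal_toReal hqt] at hpq hqQ ⊢
  push_cast
  rw [mul_assoc]
  refine eLpNorm_le_two_mul_of_le hp ((ENNReal.ofReal_le_ofReal_iff (by positivity)).1 hpq) hqQ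
    hu.continuous.aestronglyMeasurable ((hK₀ u hu h2u).trans ?_) ((hK₁ u hu h2u).trans ?_)
  · gcongr
    exact le_max_left _ _
  · gcongr
    exact le_max_right _ _

lemma eLpNorm_le_eLpNorm_fderiv_of_sobolevAdmissible (hn : 1 ≤ n) (hc : 0 < c) {p : ℝ}
    {q : ℝ≥0∞} (h : SobolevAdmissible n p q) :
    ∃ K : ℝ≥0, ∀ u : 𝔼 → ℝ, ContDiff ℝ 1 u → HasCompactSupport u →
      eLpNorm u q (expSqMeasure n c) ≤
        K * eLpNorm (fderiv ℝ u) (ENNReal.ofReal p) (expSqMeasure n c) := by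
  have hn0 : (0 : ℝ) < n := by exact_mod_cast hn
  rcases h with ⟨hp, hpn, hpq, hq⟩ | ⟨rfl, hpq, hq⟩ | ⟨hp, hpq⟩
  · refine eLpNorm_le_eLpNorm_fderiv_expSqMeasure_of_le hn hc hp hpq hq
      (eLpNorm_le_eLpNorm_fderiv_expSqMeasure_of_inv_eq hn hc hp le_rfl ?_ ?_)
    · rw [lt_div_iff₀ (by linarith)]
      nlinarith
    · have : (n : ℝ) - p ≠ 0 := by linarith
      field_simp
  · have hpq' : ENNReal.ofReal (n : ℝ) ≤ q := by rwa [ENNReal.ofReal_natCast]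
    have hn1 : (1 : ℝ) ≤ n := by exact_mod_cast hn
    rcases eq_or_lt_of_le hn with rfl | hn2
    · refine eLpNorm_le_eLpNorm_fderiv_expSqMeasure_of_le hn hc hn1 hpq' le_top
        ⟨1, fun u hu h2u => eLpNorm_top_expSqMeasure_le fun x => ?_⟩
      rw [ENNReal.coe_one, one_mul, Nat.cast_one, ENNReal.ofReal_one]
      exact (enorm_le_eLpNorm_fderiv_one_dim hu h2u x).trans
        (eLpNorm_mono_measure _ (volume_le_expSqMeasure hc))
    · have hn2' : (2 : ℝ) ≤ n := by exact_mod_cast hn2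
      -- Any finite Q > n above q is reached as the critical exponent of r = nQ/(n + Q) < n; Q ≥ 2n
      -- and n ≥ 2 also ensure r ≥ 1.
      set Q : ℝ := max q.toReal (2 * n) with hQ
      have hQn : 2 * (n : ℝ) ≤ Q := le_max_right _ _
      have hQ0 : 0 < Q := by linarith
      refine eLpNorm_le_eLpNorm_fderiv_expSqMeasure_of_le (Q := ENNReal.ofReal Q) hn hc hn1 hpq' ?_
        (eLpNorm_le_eLpNorm_fderiv_expSqMeasure_of_inv_eq (r := n * Q / (n + Q)) hn hc ?_ ?_ ?_ ?_)
      · exact ENNReal.le_ofReal_iff_toReal_le hq.ne hQ0.le |>.2 (le_max_left _ _)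
      · rw [le_div_iff₀ (by positivity)]
        nlinarith
      · rw [div_le_iff₀ (by positivity)]
        nlinarith
      · linarith
      · field_simp
        ring
  · have hp1 : 1 ≤ p := le_trans (by exact_mod_cast hn) hp.le
    obtain ⟨K, hK⟩ := enorm_le_eLpNorm_fderiv_expSqMeasure hn hc hp
    exact eLpNorm_le_eLpNorm_fderiv_expSqMeasure_of_le hn hc hp1 hpq le_top
      ⟨K, fun u hu h2u => eLpNorm_top_expSqMeasure_le (hK u hu h2u)⟩

lemma fullHolderNorm_le_eLpNorm_fderiv (hn : 1 ≤ n) (hc : 0 < c) {p : ℝ} (hp : (n : ℝ) < p) :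
    ∃ K : ℝ≥0, ∀ u : 𝔼 → ℝ, ContDiff ℝ 1 u → HasCompactSupport u →
      fullHolderNorm (Real.toNNReal (1 - n / p)) u ≤
        K * eLpNorm (fderiv ℝ u) (ENNReal.ofReal p) (expSqMeasure n c) := by
  have hp1 : 1 ≤ p := le_trans (by exact_mod_cast hn) hp.le
  have hp0 : 0 < p := by linarith
  have hα : 0 ≤ 1 - n / p := sub_nonneg.2 ((div_le_one hp0).2 hp.le)
  obtain ⟨K₀, hK₀⟩ := enorm_le_eLpNorm_fderiv_expSqMeasure hn hc hp
  obtain ⟨K₁, hK₁⟩ := enorm_sub_le_eLpNorm_fderiv (E := 𝔼) hp1 (by simpa using hp)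
  -- The extra 1 keeps the constant nonzero, so the case D = ⊤ is trivial.
  refine ⟨K₀ + (K₁ + 1), fun u hu h2u => ?_⟩
  set D := eLpNorm (fderiv ℝ u) (ENNReal.ofReal p) (expSqMeasure n c)
  rcases eq_or_ne D ⊤ with hD | hD
  · rw [hD, ENNReal.mul_top (by positivity)]
    exact le_top
  push_cast
  rw [add_mul, fullHolderNorm]
  refine add_le_add (iSup_le (hK₀ u hu h2u)) ?_
  have hH : HolderWith (K₁ * D.toNNReal) (Real.toNNReal (1 - n / p)) u := by
    intro x y
    rw [edist_eq_enorm_sub, edist_dist, dist_eq_norm, Real.coe_toNNReal _ hα]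
    refine (hK₁ u hu x y).trans ?_
    rw [ENNReal.ofReal_rpow_of_nonneg (norm_nonneg _) hα, ENNReal.coe_mul,
      ENNReal.coe_toNNReal hD, finrank_euclideanSpace_fin]
    gcongr
    exact eLpNorm_mono_measure _ (volume_le_expSqMeasure hc)
  refine hH.eHolderNorm_le.trans ?_
  rw [ENNReal.coe_mul, ENNReal.coe_toNNReal hD]
  gcongr
  exact le_self_add

lemma eLpNorm_gradient (u : 𝔼 → ℝ) (p : ℝ≥0∞) (μ : Measure 𝔼) :
    eLpNorm (gradient u) p μ = eLpNorm (fderiv ℝ u) p μ :=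
  eLpNorm_congr_norm_ae (Filter.Eventually.of_forall fun x => by simp [gradient])

/-- Inverting K + 1 rather than K gives a positive real C even when K = 0. -/
lemma exists_ofReal_mul_le_of_le_mul {ι : Type*} {P : ι → Prop} {a d : ι → ℝ≥0∞} {K : ℝ≥0}
    (h : ∀ i, P i → a i ≤ K * d i) : ∃ C : ℝ, 0 < C ∧ ∀ i, P i → ENNReal.ofReal C * a i ≤ d i := by
  refine ⟨((K + 1 : ℝ≥0) : ℝ)⁻¹, by positivity, fun i hi => ?_⟩
  rw [ENNReal.ofReal_inv_of_pos (by positivity), ENNReal.ofReal_coe_nnreal, mul_comm,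
    ← div_eq_mul_inv]
  refine ENNReal.div_le_of_le_mul' ((h i hi).trans ?_)
  gcongr
  exact le_self_add

end Weighted

theorem mainTheorem6 (n : ℕ) (hn : 1 ≤ n) (c : ℝ) (hc : 0 < c) :
    (∀ (p : ℝ) (q : ℝ≥0∞), SobolevAdmissible n p q →
      ∃ C : ℝ, 0 < C ∧ ∀ u : EuclideanSpace ℝ (Fin n) → ℝ,
        ContDiff ℝ ∞ u → HasCompactSupport u →
          ENNReal.ofReal C * eLpNorm u q (expSqMeasure n c) ≤
            eLpNorm (gradient u) (ENNReal.ofReal p) (expSqMeasure n c)) ∧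
    (∀ p : ℝ, (n : ℝ) < p →
      ∃ C : ℝ, 0 < C ∧ ∀ u : EuclideanSpace ℝ (Fin n) → ℝ,
        ContDiff ℝ ∞ u → HasCompactSupport u →
          ENNReal.ofReal C * fullHolderNorm (Real.toNNReal (1 - n / p)) u ≤
            eLpNorm (gradient u) (ENNReal.ofReal p) (expSqMeasure n c)) := by
  simp only [eLpNorm_gradient, ← and_imp]
  refine ⟨fun p q h => ?_, fun p hp => ?_⟩
  · obtain ⟨K, hK⟩ := eLpNorm_le_eLpNorm_fderiv_of_sobolevAdmissible hn hc h
    exact exists_ofReal_mul_le_of_le_mul fun u hu => hK u (hu.1.of_le (by simp)) hu.2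
  · obtain ⟨K, hK⟩ := fullHolderNorm_le_eLpNorm_fderiv hn hc hp
    exact exists_ofReal_mul_le_of_le_mul fun u hu => hK u (hu.1.of_le (by simp)) hu.2
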